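/- Let $n$ jobs with weights $w_1,\dots,w_n>0$ be scheduled without preemption on $m\ge 1$ identical parallel machines, each machine processing at most one job at a time. The processing times $\boldsymbol p_1,\dots,\boldsymbol p_n$ are independent, almost surely positive random variables with finite second moments, and $\Delta$ is a real number with $\mathrm{Var}[\boldsymbol p_j]/\mathrm E[\boldsymbol p_j]^2\le\Delta$ for all $j$. A non-anticipative policy is a rule that decides at each time $t\ge 0$ which jobs to start on which idle machines, based only on the weights, the distributions of the processing times, and the past observed up to time $t$ (the start times and machines of the jobs started before $t$, and the processing times of those completed by time $t$), with start times depending measurably on the processing times; $\boldsymbol C_j^{\Pi}$ denotes the random completion time of job $j$ under the policy $\Pi$. A policy follows the WSEPT (weighted shortest expected processing time) rule if it starts the jobs in order of non-increasing ratios $w_j/\mathrm E[\boldsymbol p_j]$ (ties broken arbitrarily) and leaves no machine idle as long as some job has not been started. Then the WSEPT rule has performance ratio $1+\tfrac12(\sqrt2-1)(1+\Delta)$ for the problem of minimizing the expected total weighted completion time over all non-anticipative policies. That is, there is a non-anticipative policy following the WSEPT rule, and every such policy $\Pi$ satisfies $$\mathrm E\Bigl[\sum_{j=1}^n w_j\boldsymbol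 C_j^{\Pi}\Bigr]\;\le\;\Bigl(1+\tfrac12(\sqrt2-1)(1+\Delta)\Bigr)\cdot\inf_{\Pi'}\,\mathrm E\Bigl[\sum_{j=1}^n w_j\boldsymbol C_j^{\Pi'}\Bigr],$$ where $\Pi'$ ranges over all non-anticipative policies for the same $m$ machines. -/

import Mathlib

open MeasureTheory ProbabilityTheory
open scoped ENNReal

/-- A (non-preemptive) schedule of `n` jobs on `m` machines: for every job, the machine on which it
is processed and the time at which it is started. -/
structure Schedule (n m : ℕ) where
  machine : Fin n → Fin m
  start : Fin n → ℝ

/-- Completion time of job `j`, if the processing times are `p`. -/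
def Schedule.completion {n m : ℕ} (S : Schedule n m) (p : Fin n → ℝ) (j : Fin n) : ℝ :=
  S.start j + p j

/-- Feasibility for the processing times `p`: no job starts before time `0`, and every machine
processes at most one job at a time. -/
def Schedule.Feasible {n m : ℕ} (S : Schedule n m) (p : Fin n → ℝ) : Prop :=
  (∀ j, 0 ≤ S.start j) ∧
    ∀ i j, i ≠ j → S.machine i = S.machine j →
      S.completion p i ≤ S.start j ∨ S.completion p j ≤ S.start i

/-- Machine `k` is busy at time `t` (jobs occupy half-open time intervals). -/
def Schedule.Busy {n m : ℕ} (S : Schedule n m) (p : Fin n → ℝ) (k : Fin m) (t : ℝ) : Prop :=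
  ∃ i, S.machine i = k ∧ S.start i ≤ t ∧ t < S.completion p i

/-- The schedule `S` under the realization `p` and the schedule `S'` under the realization `p'` look
the same to an observer at time `t`, before the decisions of time `t` are taken: the same jobs were
started before time `t`, at the same times and on the same machines, and for each of these jobs
either the processing times agree or the job is still unfinished at time `t` in both cases. -/
def SamePast {n m : ℕ} (S S' : Schedule n m) (p p' : Fin n → ℝ) (t : ℝ) : Prop :=
  ∀ j, S.start j < t ∨ S'.start j < t →
    S.start j = S'.start j ∧ S.machine j = S'.machine j ∧
      (p j = p' j ∨ (t < S.completion p j ∧ t < S'.completion p' j))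

/-- A non-anticipative scheduling policy for `n` jobs on `m` identical parallel machines, given by
the schedule that it produces for each realization of the (positive) processing times. The jobs
started at time `t`, and their machines, may only depend on what was observed up to time `t`. -/
structure Policy (n m : ℕ) where
  schedule : (Fin n → ℝ) → Schedule n m
  measurable_start : ∀ j, Measurable fun p => (schedule p).start j
  feasible : ∀ p, (∀ j, 0 < p j) → (schedule p).Feasible p
  nonanticipative : ∀ p p', (∀ j, 0 < p j) → (∀ j, 0 < p' j) →
    ∀ t, SamePast (schedule p) (schedule p') p p' t →
      ∀ j, (schedule p).start j = t →
        (schedule p').start j = t ∧ (schedule p').machine j = (schedule p).machine j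

/-- The policy schedules the jobs greedily in order of non-increasing ratios `ρ`: under every
realization no job is started before a job of larger ratio, and as long as some job has not been
started, no machine is idle. Ties between equal ratios may be broken arbitrarily. -/
def Policy.IsGreedyInOrder {n m : ℕ} (π : Policy n m) (ρ : Fin n → ℝ) : Prop :=
  ∀ p, (∀ j, 0 < p j) →
    (∀ i j, ρ j < ρ i → (π.schedule p).start i ≤ (π.schedule p).start j) ∧
      ∀ j t, 0 ≤ t → t < (π.schedule p).start j → ∀ k, (π.schedule p).Busy p k t

/-- The policy follows the WSEPT rule for the weights `w` and the random processing times `P`. -/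
def Policy.IsWSEPT {n m : ℕ} {Ω : Type*} [MeasurableSpace Ω] (π : Policy n m) (w : Fin n → ℝ)
    (P : Fin n → Ω → ℝ) (μ : Measure Ω) : Prop :=
  π.IsGreedyInOrder fun j => w j / ∫ ω, P j ω ∂μ

/-- Expected total weighted completion time of a policy, a value in `[0, ∞]`. -/
noncomputable def Policy.expectedCost {n m : ℕ} {Ω : Type*} [MeasurableSpace Ω] (π : Policy n m)
    (w : Fin n → ℝ) (P : Fin n → Ω → ℝ) (μ : Measure Ω) : ℝ≥0∞ :=
  ∫⁻ ω, ENNReal.ofReal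
    (∑ j, w j * (π.schedule fun i => P i ω).completion (fun i => P i ω) j) ∂μ

/-- The infimum of the expected costs of all non-anticipative policies on `m` machines. -/
noncomputable def optimalExpectedCost {n : ℕ} (m : ℕ) {Ω : Type*} [MeasurableSpace Ω]
    (w : Fin n → ℝ) (P : Fin n → Ω → ℝ) (μ : Measure Ω) : ℝ≥0∞ :=
  ⨅ π : Policy n m, π.expectedCost w P μ

/-! ### Deterministic schedules: start times and squared machine loads. -/

section Deterministic

variable {n m : ℕ}

/-! Write β = (√2 - 1)/2 and let S_j be the start times. Non-anticipativity makes S_j independent of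
the processing time p_j, so E[p_j] E[S_j] = E[p_j S_j] for every policy. Hence, if the weights are
the expected processing times, the start-time part of the cost can be compared realization by
realization, with the actual p_j as weights. This is the deterministic problem with all ratios equal
to 1, where the Kawaguchi–Kyan argument (`sum_mul_start_le`) gives Σ p_j S_j ≤ (1 + β) Σ p_j S'_j +
β Σ p_j². Taking expectations, using E[p_j²] ≤ (1 + Δ) E[p_j]² and adding E[p_j]² for the processing
itself yields the factor 1 + β(1 + Δ).

General weights reduce to this case by a layer-cake decomposition of the ratios ρ_j: the cost is an
integral over c > 0 of costs with weights E[p_j] on the jobs with ρ_j ≥ c, and a greedy schedule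
restricted to such a set is still greedy (`exists_busy`).

For the deterministic bound, Σ p_j S_j is expressed by the squared machine loads. If T is the last
start of the greedy schedule and ℓ = √2 T, both schedules are compared with Σ_k (2ℓ L_k - ℓ²) + Σ_i
max(p_i - ℓ, 0)², which does not depend on the assignment of jobs to machines. -/

/-- Jobs occupying disjoint time intervals in `[0, t]` have total length at most `t`. -/
theorem sum_le_of_disjoint_intervals {ι : Type*} [DecidableEq ι] (A : Finset ι) (s p : ι → ℝ)
    (hp : ∀ i ∈ A, 0 < p i) (hs : ∀ i ∈ A, 0 ≤ s i)
    (hd : ∀ i ∈ A, ∀ j ∈ A, i ≠ j → s i + p i ≤ s j ∨ s j + p j ≤ s i) :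
    ∀ t, 0 ≤ t → (∀ i ∈ A, s i + p i ≤ t) → ∑ i ∈ A, p i ≤ t := by
  induction A using Finset.induction_on_max_value s with
  | empty => intro t ht _; simpa using ht
  | insert a A ha hmax ih =>
    intro t _ hA
    rw [Finset.sum_insert ha]
    have h1 : ∑ i ∈ A, p i ≤ s a := by
      refine ih (fun i hi => hp i (Finset.mem_insert_of_mem hi))
        (fun i hi => hs i (Finset.mem_insert_of_mem hi))
        (fun i hi j hj => hd i (Finset.mem_insert_of_mem hi) j (Finset.mem_insert_of_mem hj))
        (s a) (hs a (Finset.mem_insert_self _ _)) fun i hi => ?_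
      rcases hd i (Finset.mem_insert_of_mem hi) a (Finset.mem_insert_self _ _)
        (fun h => ha (h ▸ hi)) with h | h
      · exact h
      · have := hmax i hi
        have := hp a (Finset.mem_insert_self _ _)
        linarith
    have := hA a (Finset.mem_insert_self _ _)
    linarith

/-- If jobs cover `[0, t)`, their total length is at least `t`. -/
theorem le_sum_of_cover {ι : Type*} (A : Finset ι) (s p : ι → ℝ) (hp : ∀ i ∈ A, 0 ≤ p i) (t : ℝ)
    (h : ∀ u, 0 ≤ u → u < t → ∃ i ∈ A, s i ≤ u ∧ u < s i + p i) : t ≤ ∑ i ∈ A, p i := by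
  have hsub : Set.Ico 0 t ⊆ ⋃ i ∈ A, Set.Ico (s i) (s i + p i) := by
    intro u hu
    obtain ⟨i, hi, h1, h2⟩ := h u hu.1 hu.2
    simp only [Set.mem_iUnion]
    exact ⟨i, hi, h1, h2⟩
  have h1 := (measure_mono (μ := volume) hsub).trans (measure_biUnion_finset_le A _)
  simp only [Real.volume_Ico, sub_zero, add_sub_cancel_left] at h1
  rw [← ENNReal.ofReal_sum_of_nonneg hp] at h1
  exact (ENNReal.ofReal_le_ofReal_iff (Finset.sum_nonneg hp)).1 h1

/-- The jobs of `J` that are processed on machine `k`. -/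
def Schedule.jobsOn (S : Schedule n m) (J : Finset (Fin n)) (k : Fin m) : Finset (Fin n) :=
  J.filter fun i => S.machine i = k

theorem Schedule.mem_jobsOn {S : Schedule n m} {J : Finset (Fin n)} {k : Fin m} {i : Fin n} :
    i ∈ S.jobsOn J k ↔ i ∈ J ∧ S.machine i = k := by
  simp [Schedule.jobsOn]

theorem Schedule.sum_jobsOn (S : Schedule n m) (J : Finset (Fin n)) (f : Fin n → ℝ) :
    ∑ k, ∑ i ∈ S.jobsOn J k, f i = ∑ i ∈ J, f i :=
  Finset.sum_fiberwise J S.machine f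

theorem Schedule.Feasible.start_ne {S : Schedule n m} {p : Fin n → ℝ} (hS : S.Feasible p)
    (hp : ∀ j, 0 < p j) {i j : Fin n} (hij : i ≠ j) (hm : S.machine i = S.machine j) :
    S.start i ≠ S.start j := by
  intro h
  have hi := hp i
  have hj := hp j
  rcases hS.2 i j hij hm with h1 | h1 <;> unfold Schedule.completion at h1 <;> linarith

/-- The jobs started earlier on the machine of a job fit before its start. -/
theorem Schedule.Feasible.sum_earlier_le {S : Schedule n m} {p : Fin n → ℝ} (hS : S.Feasible p)
    (hp : ∀ j, 0 < p j) (J : Finset (Fin n)) (j : Fin n) :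
    ∑ i ∈ (S.jobsOn J (S.machine j)).filter (fun i => S.start i < S.start j), p i
      ≤ S.start j := by
  refine sum_le_of_disjoint_intervals _ S.start p (fun i _ => hp i) (fun i _ => hS.1 i) ?_ _
    (hS.1 j) ?_
  · intro i hi l hl hil
    simp only [Finset.mem_filter, Schedule.mem_jobsOn] at hi hl
    exact hS.2 i l hil (hi.1.2.trans hl.1.2.symm)
  · intro i hi
    simp only [Finset.mem_filter, Schedule.mem_jobsOn] at hi
    rcases hS.2 i j (by rintro rfl; exact lt_irrefl _ hi.2) hi.1.2 with h | h
    · exact h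
    · have := hp j
      unfold Schedule.completion at h
      linarith [hi.2]

/-- Products over the ordered pairs of jobs of one machine. -/
theorem sum_mul_sum_earlier {ι : Type*} [DecidableEq ι] (A : Finset ι) (s p : ι → ℝ)
    (hs : ∀ i ∈ A, ∀ j ∈ A, i ≠ j → s i ≠ s j) :
    2 * ∑ j ∈ A, p j * ∑ i ∈ A.filter (fun i => s i < s j), p i =
      (∑ j ∈ A, p j) ^ 2 - ∑ j ∈ A, p j ^ 2 := by
  have h1 : ∑ j ∈ A, p j * ∑ i ∈ A.filter (fun i => s i < s j), p i =
      ∑ j ∈ A, ∑ i ∈ A, if s i < s j then p j * p i else 0 := by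
    refine Finset.sum_congr rfl fun j _ => ?_
    rw [Finset.mul_sum, Finset.sum_filter]
  have h2 : ∑ j ∈ A, ∑ i ∈ A, (if s i < s j then p j * p i else 0) =
      ∑ j ∈ A, ∑ i ∈ A, if s j < s i then p j * p i else 0 := by
    rw [Finset.sum_comm]
    simp only [mul_comm]
  have h3 : ∑ j ∈ A, p j ^ 2 = ∑ j ∈ A, ∑ i ∈ A, if j = i then p j * p i else 0 := by
    refine Finset.sum_congr rfl fun j hj => ?_
    rw [Finset.sum_ite_eq A j, if_pos hj, sq]
  have h4 : (∑ j ∈ A, p j) ^ 2 = ∑ j ∈ A, ∑ i ∈ A, p j * p i := by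
    rw [sq, Finset.sum_mul_sum]
  rw [two_mul, h1]
  nth_rewrite 2 [h2]
  rw [h3, h4, eq_sub_iff_add_eq, ← Finset.sum_add_distrib, ← Finset.sum_add_distrib]
  refine Finset.sum_congr rfl fun j hj => ?_
  rw [← Finset.sum_add_distrib, ← Finset.sum_add_distrib]
  refine Finset.sum_congr rfl fun i hi => ?_
  by_cases hij : j = i
  · subst hij; simp
  · rcases lt_or_gt_of_ne (hs j hj i hi hij) with h | h
    · simp [hij, h, h.not_gt]
    · simp [hij, h, h.not_gt]

/-- The inner sum is at most the start of `j` in any feasible schedule and at least that start in a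
greedy one, so this turns weighted start times into squared loads. -/
theorem Schedule.Feasible.two_mul_sum_earlier {S : Schedule n m} {p : Fin n → ℝ}
    (hS : S.Feasible p) (hp : ∀ j, 0 < p j) (J : Finset (Fin n)) :
    2 * ∑ j ∈ J, p j *
        ∑ i ∈ (S.jobsOn J (S.machine j)).filter (fun i => S.start i < S.start j), p i =
      ∑ k, (∑ i ∈ S.jobsOn J k, p i) ^ 2 - ∑ j ∈ J, p j ^ 2 := by
  rw [← S.sum_jobsOn J, ← S.sum_jobsOn J, Finset.mul_sum, ← Finset.sum_sub_distrib]
  refine Finset.sum_congr rfl fun k _ => ?_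
  rw [← sum_mul_sum_earlier (S.jobsOn J k) S.start p fun i hi j hj hij =>
    hS.start_ne hp hij ((mem_jobsOn.1 hi).2.trans (mem_jobsOn.1 hj).2.symm)]
  congr 1
  refine Finset.sum_congr rfl fun j hj => ?_
  rw [(mem_jobsOn.1 hj).2]

/-! ### The Kawaguchi–Kyan bound for equal ratios. -/

/-- On one machine, with `T` the last start and `y` the part of the load
after `T`. -/
theorem sq_load_le (T y : ℝ) (hy : 0 ≤ y) :
    (T + y) ^ 2 ≤ (1 + 1 / 2 * (√2 - 1)) *
      (2 * (√2 * T) * (T + y) - (√2 * T) ^ 2 + (max (y - √2 * T) 0) ^ 2) +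
        1 / 2 * (√2 - 1) * y ^ 2 := by
  have h2 : √2 ^ 2 = 2 := Real.sq_sqrt (by norm_num)
  have h1 : 1 < √2 := by
    rw [Real.lt_sqrt] <;> norm_num
  have h3 : √2 < 3 / 2 := by
    rw [Real.sqrt_lt'] <;> norm_num
  generalize √2 = c at *
  rcases le_total y (c * T) with h | h
  · rw [max_eq_right (by linarith)]
    -- With c² = 2 the T² terms cancel; the difference is y (cT - (3 - c)/2 · y), and (3 - c)/2 < 1.
    nlinarith [mul_nonneg hy (sub_nonneg.2 h)]
  · rw [max_eq_left (by linarith)]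
    -- The difference is exactly (c - 1)(y - (c + 1)T)², because (c - 1)(c + 1) = 1.
    nlinarith [mul_nonneg (sub_nonneg.2 h1.le) (sq_nonneg (y - (c + 1) * T))]

/-- With L the total, L² = 2lL - l² + (L - l)², and positive excesses over l, like squares of
nonnegative numbers, are superadditive. Summed over machines, the left side no longer depends on the
assignment. -/
theorem sum_sq_posPart_le {ι : Type*} (A : Finset ι) (p : ι → ℝ) (hp : ∀ i ∈ A, 0 ≤ p i) (l : ℝ)
    (hl : 0 ≤ l) :
    2 * l * ∑ i ∈ A, p i - l ^ 2 + ∑ i ∈ A, (max (p i - l) 0) ^ 2 ≤ (∑ i ∈ A, p i) ^ 2 := by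
  classical
  have key : ∑ i ∈ A, (max (p i - l) 0) ^ 2 ≤ (max (∑ i ∈ A, p i - l) 0) ^ 2 := by
    induction A using Finset.induction_on with
    | empty => simp
    | insert a A ha ih =>
      rw [Finset.sum_insert ha, Finset.sum_insert ha]
      have ih := ih fun i hi => hp i (Finset.mem_insert_of_mem hi)
      have hA : 0 ≤ ∑ i ∈ A, p i := Finset.sum_nonneg fun i hi => hp i (Finset.mem_insert_of_mem hi)
      have ha := hp a (Finset.mem_insert_self _ _)
      set x := ∑ i ∈ A, p i
      have h1 : max (p a - l) 0 + max (x - l) 0 ≤ max (p a + x - l) 0 := by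
        rcases max_cases (p a - l) 0 with h | h <;> rcases max_cases (x - l) 0 with h' | h' <;>
        rcases max_cases (p a + x - l) 0 with h'' | h'' <;> linarith
      have h2 : 0 ≤ max (p a - l) 0 := le_max_right _ _
      have h3 : 0 ≤ max (x - l) 0 := le_max_right _ _
      calc _ ≤ (max (p a - l) 0) ^ 2 + (max (x - l) 0) ^ 2 := by linarith
        _ ≤ (max (p a - l) 0 + max (x - l) 0) ^ 2 := by nlinarith [mul_nonneg h2 h3]
        _ ≤ _ := by gcongr
  have : (max (∑ i ∈ A, p i - l) 0) ^ 2 ≤ (∑ i ∈ A, p i - l) ^ 2 := by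
    rcases max_cases (∑ i ∈ A, p i - l) 0 with h | h <;> rw [h.1]
    nlinarith [sq_nonneg (∑ i ∈ A, p i - l)]
  nlinarith

/-- The bound of Kawaguchi and Kyan for jobs of equal ratio, in terms of the start times. -/
theorem sum_mul_start_le {S S' : Schedule n m} {p : Fin n → ℝ} (hp : ∀ j, 0 < p j)
    (hS : S.Feasible p) (hS' : S'.Feasible p) (J : Finset (Fin n))
    (hg : ∀ j ∈ J, ∀ t, 0 ≤ t → t < S.start j → ∀ k,
      ∃ i ∈ J, S.machine i = k ∧ S.start i ≤ t ∧ t < S.completion p i) :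
    ∑ j ∈ J, p j * S.start j ≤
      (1 + 1 / 2 * (√2 - 1)) * ∑ j ∈ J, p j * S'.start j +
        1 / 2 * (√2 - 1) * ∑ j ∈ J, p j ^ 2 := by
  rcases J.eq_empty_or_nonempty with rfl | hJ
  · simp
  obtain ⟨j₀, hj₀, hmax⟩ := J.exists_max_image S.start hJ
  have h1 : 1 < √2 := by
    rw [Real.lt_sqrt] <;> norm_num
  have hcover : ∀ j ∈ J, ∀ k, S.start j ≤
      ∑ i ∈ (S.jobsOn J k).filter (fun i => S.start i < S.start j), p i := by
    intro j hj k
    refine le_sum_of_cover _ S.start p (fun i _ => (hp i).le) _ fun u hu hu' => ?_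
    obtain ⟨i, hi, hk, h1, h2⟩ := hg j hj u hu hu' k
    exact ⟨i, by simp [Schedule.mem_jobsOn, hi, hk, h1.trans_lt hu'], h1, h2⟩
  set T := S.start j₀
  have hT : 0 ≤ T := hS.1 j₀
  have hload : ∀ k, T ≤ ∑ i ∈ S.jobsOn J k, p i := fun k =>
    (hcover j₀ hj₀ k).trans (Finset.sum_le_sum_of_subset_of_nonneg (Finset.filter_subset _ _)
      fun i _ _ => (hp i).le)
  have hmach : ∀ k, (∑ i ∈ S.jobsOn J k, p i) ^ 2 ≤ (1 + 1 / 2 * (√2 - 1)) *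
      (2 * (√2 * T) * (∑ i ∈ S.jobsOn J k, p i) - (√2 * T) ^ 2 +
        ∑ i ∈ S.jobsOn J k, (max (p i - √2 * T) 0) ^ 2) +
        1 / 2 * (√2 - 1) * ∑ i ∈ S.jobsOn J k, p i ^ 2 := by
    intro k
    set A := S.jobsOn J k with hA
    obtain ⟨y, hy⟩ : ∃ y, ∑ i ∈ A, p i = T + y := ⟨∑ i ∈ A, p i - T, by ring⟩
    have hy0 : 0 ≤ y := by have := hload k; linarith
    -- The last job on the machine starts no later than `T`, so it alone accounts for the load
    -- beyond `T`.
    have hlast : (max (y - √2 * T) 0) ^ 2 ≤ ∑ i ∈ A, (max (p i - √2 * T) 0) ^ 2 ∧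
        y ^ 2 ≤ ∑ i ∈ A, p i ^ 2 := by
      rcases A.eq_empty_or_nonempty with hA0 | hA0
      · rw [hA0] at hy ⊢
        simp only [Finset.sum_empty] at hy ⊢
        have hy' : y = 0 := by linarith
        have hT' : T = 0 := by linarith
        simp [hy', hT']
      · obtain ⟨l, hl, hlmax⟩ := A.exists_max_image S.start hA0
        have hl' := Schedule.mem_jobsOn.1 hl
        have hsub : A ⊆ insert l (A.filter fun i => S.start i < S.start l) := by
          intro i hi
          by_cases hil : i = l
          · simp [hil]
          · refine Finset.mem_insert_of_mem (Finset.mem_filter.2 ⟨hi, lt_of_le_of_ne (hlmax i hi) ?_⟩)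
            exact hS.start_ne hp hil ((Schedule.mem_jobsOn.1 hi).2.trans hl'.2.symm)
        have hsum : ∑ i ∈ A, p i ≤ p l + S.start l := by
          refine (Finset.sum_le_sum_of_subset_of_nonneg hsub fun i _ _ => (hp i).le).trans ?_
          rw [Finset.sum_insert (by simp)]
          have := hS.sum_earlier_le hp J l
          rw [hl'.2] at this
          linarith
        have hyl : y ≤ p l := by have := hmax l hl'.1; linarith
        constructor
        · refine le_trans ?_ (Finset.single_le_sum (f := fun i => (max (p i - √2 * T) 0) ^ 2)
            (fun i _ => sq_nonneg _) hl)
          gcongr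
        · refine le_trans ?_ (Finset.single_le_sum (f := fun i => p i ^ 2)
            (fun i _ => sq_nonneg _) hl)
          gcongr
    rw [hy]
    refine (sq_load_le T y hy0).trans ?_
    have := hlast.1
    have := hlast.2
    gcongr
  have hsq : ∑ k, (∑ i ∈ S.jobsOn J k, p i) ^ 2 ≤ (1 + 1 / 2 * (√2 - 1)) *
      ∑ k, (∑ i ∈ S'.jobsOn J k, p i) ^ 2 + 1 / 2 * (√2 - 1) * ∑ i ∈ J, p i ^ 2 := by
    refine (Finset.sum_le_sum fun k _ => hmach k).trans ?_
    -- Summing over machines leaves only sums over `J`, which are the same for `S` and `S'`.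
    rw [Finset.sum_add_distrib, ← Finset.mul_sum, ← Finset.mul_sum, S.sum_jobsOn,
      Finset.sum_add_distrib, Finset.sum_sub_distrib, ← Finset.mul_sum, S.sum_jobsOn, S.sum_jobsOn]
    have h := Finset.sum_le_sum fun k (_ : k ∈ Finset.univ) =>
      sum_sq_posPart_le (S'.jobsOn J k) p (fun i _ => (hp i).le) (√2 * T) (by positivity)
    rw [Finset.sum_add_distrib, Finset.sum_sub_distrib, ← Finset.mul_sum, S'.sum_jobsOn,
      S'.sum_jobsOn] at h
    gcongr
  have hup : ∑ j ∈ J, p j * S.start j ≤ ∑ j ∈ J, p j *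
        ∑ i ∈ (S.jobsOn J (S.machine j)).filter (fun i => S.start i < S.start j), p i :=
    Finset.sum_le_sum fun j hj => mul_le_mul_of_nonneg_left (hcover j hj _) (hp j).le
  have hlow : ∑ j ∈ J, p j *
        ∑ i ∈ (S'.jobsOn J (S'.machine j)).filter (fun i => S'.start i < S'.start j), p i ≤
      ∑ j ∈ J, p j * S'.start j :=
    Finset.sum_le_sum fun j _ => mul_le_mul_of_nonneg_left (hS'.sum_earlier_le hp J j) (hp j).le
  have e1 := hS.two_mul_sum_earlier hp J
  have e2 := hS'.two_mul_sum_earlier hp J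
  have h5 : (1 + 1 / 2 * (√2 - 1)) * ∑ k, (∑ i ∈ S'.jobsOn J k, p i) ^ 2 ≤
      (1 + 1 / 2 * (√2 - 1)) * (2 * ∑ j ∈ J, p j * S'.start j + ∑ j ∈ J, p j ^ 2) := by
    gcongr
    linarith
  linarith

end Deterministic

/-! ### Independence of start and processing times. -/

section Stochastic

variable {n m : ℕ}

theorem SamePast.symm {S S' : Schedule n m} {p p' : Fin n → ℝ} {t : ℝ} (h : SamePast S S' p p' t) :
    SamePast S' S p' p t := fun j hj =>
  let ⟨h1, h2, h3⟩ := h j hj.symm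
  ⟨h1.symm, h2.symm, h3.imp Eq.symm And.symm⟩

/-- The start time of a job does not depend on its own processing time. -/
theorem Policy.start_eq_of_eq_off (π : Policy n m) {p p' : Fin n → ℝ} (hp : ∀ j, 0 < p j)
    (hp' : ∀ j, 0 < p' j) (j : Fin n) (h : ∀ i, i ≠ j → p i = p' i) :
    (π.schedule p).start j = (π.schedule p').start j := by
  by_contra hne
  let D := Finset.univ.filter fun i => (π.schedule p).start i ≠ (π.schedule p').start i ∨
    (π.schedule p).machine i ≠ (π.schedule p').machine i
  have hjD : j ∈ D := by simp [D, hne]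
  obtain ⟨i, hiD, hmin⟩ := D.exists_min_image
    (fun i => min ((π.schedule p).start i) ((π.schedule p').start i)) ⟨j, hjD⟩
  set u := min ((π.schedule p).start i) ((π.schedule p').start i) with hu
  -- `u` is the first time at which the schedules differ. Since `j` itself belongs to `D`, it has
  -- not started before `u`, so its processing time has not been observed.
  have hpast : SamePast (π.schedule p) (π.schedule p') p p' u := by
    intro l hl
    have hlD : l ∉ D := fun hlD => (hmin l hlD).not_gt (min_lt_iff.2 hl)
    have hlj : l ≠ j := fun hlj => hlD (hlj ▸ hjD)
    simp only [D, Finset.mem_filter, Finset.mem_univ, true_and, not_or, not_not] at hlD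
    exact ⟨hlD.1, hlD.2, Or.inl (h l hlj)⟩
  simp only [D, Finset.mem_filter, Finset.mem_univ, true_and] at hiD
  rcases min_choice ((π.schedule p).start i) ((π.schedule p').start i) with hc | hc
  · have hs : (π.schedule p).start i = u := hc.symm
    have := π.nonanticipative p p' hp hp' u hpast i hs
    rcases hiD with h1 | h1
    · exact h1 (hs.trans this.1.symm)
    · exact h1 this.2.symm
  · have hs : (π.schedule p').start i = u := hc.symm
    have := π.nonanticipative p' p hp' hp u hpast.symm i hs
    rcases hiD with h1 | h1
    · exact h1 (this.1.trans hs.symm)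
    · exact h1 this.2

variable {Ω : Type*} [MeasurableSpace Ω] {μ : Measure Ω} {P : Fin n → Ω → ℝ}

theorem Policy.aemeasurable_start (π : Policy n m) (hP : ∀ j, AEMeasurable (P j) μ) (j : Fin n) :
    AEMeasurable (fun ω => ENNReal.ofReal ((π.schedule fun i => P i ω).start j)) μ :=
  ((π.measurable_start j).comp_aemeasurable (aemeasurable_pi_lambda _ hP)).ennreal_ofReal

/-- Given a job `j`, a random variable determined by the other processing times is independent of
the processing time of `j`. -/
theorem indepFun_of_update_eq (hP : ∀ j, AEMeasurable (P j) μ) (hind : iIndepFun P μ) (j : Fin n)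
    {f : (Fin n → ℝ) → ℝ} (hf : Measurable f) :
    IndepFun (P j) (fun ω => f (Function.update (fun i => P i ω) j 1)) μ := by
  have hext : Measurable fun (q : ↥(Finset.univ.erase j) → ℝ) (i : Fin n) =>
      if h : i ∈ Finset.univ.erase j then q ⟨i, h⟩ else 1 := by
    refine measurable_pi_lambda _ fun i => ?_
    by_cases h : i ∈ Finset.univ.erase j
    · simpa only [h, dite_true] using measurable_pi_apply _
    · simp only [h, dite_false, measurable_const]
  have h1 := hind.indepFun_finset₀ {j} (Finset.univ.erase j) (by simp) hP
  have h2 := h1.comp (measurable_pi_apply (⟨j, Finset.mem_singleton_self j⟩ : ({j} : Finset (Fin n))))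
    (hf.comp hext)
  refine h2.congr (ae_of_all _ fun ω => rfl) (ae_of_all _ fun ω => ?_)
  refine congrArg f (funext fun i => ?_)
  by_cases h : i = j
  · subst h; simp
  · simp [h]

/-- Processing time and start time of a job are uncorrelated. -/
theorem Policy.lintegral_mul_start (π : Policy n m) (hP : ∀ j, AEMeasurable (P j) μ)
    (hind : iIndepFun P μ) (hpos : ∀ j, ∀ᵐ ω ∂μ, 0 < P j ω) (j : Fin n) :
    ∫⁻ ω, ENNReal.ofReal (P j ω) *
        ENNReal.ofReal ((π.schedule fun i => P i ω).start j) ∂μ =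
      (∫⁻ ω, ENNReal.ofReal (P j ω) ∂μ) *
        ∫⁻ ω, ENNReal.ofReal ((π.schedule fun i => P i ω).start j) ∂μ := by
  refine lintegral_mul_eq_lintegral_mul_lintegral_of_indepFun'' (hP j).ennreal_ofReal
    (π.aemeasurable_start hP j) ?_
  -- Overwriting coordinate `j` by a positive constant leaves the start of `j` unchanged almost
  -- surely.
  refine ((indepFun_of_update_eq hP hind j (π.measurable_start j)).comp
    ENNReal.measurable_ofReal ENNReal.measurable_ofReal).congr (ae_of_all _ fun ω => rfl) ?_
  filter_upwards [ae_all_iff.2 hpos] with ω hω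
  refine congrArg ENNReal.ofReal (π.start_eq_of_eq_off (fun i => ?_) hω j fun i hi => ?_)
  · by_cases h : i = j
    · subst h; simp
    · simpa [h] using hω i
  · simp [hi]

theorem Policy.expectedCost_eq (π : Policy n m) {w : Fin n → ℝ} (hw : ∀ j, 0 < w j)
    (hP : ∀ j, AEMeasurable (P j) μ) (hpos : ∀ j, ∀ᵐ ω ∂μ, 0 < P j ω) :
    π.expectedCost w P μ = ∑ j, ENNReal.ofReal (w j) *
      (∫⁻ ω, ENNReal.ofReal ((π.schedule fun i => P i ω).start j) ∂μ +
        ∫⁻ ω, ENNReal.ofReal (P j ω) ∂μ) := by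
  have h1 : π.expectedCost w P μ = ∫⁻ ω, ∑ j, ENNReal.ofReal (w j) *
      (ENNReal.ofReal ((π.schedule fun i => P i ω).start j) + ENNReal.ofReal (P j ω)) ∂μ := by
    refine lintegral_congr_ae ?_
    filter_upwards [ae_all_iff.2 hpos] with ω hω
    have hs := (π.feasible _ hω).1
    unfold Schedule.completion
    rw [ENNReal.ofReal_sum_of_nonneg fun j _ =>
      mul_nonneg (hw j).le (add_nonneg (hs j) (hω j).le)]
    refine Finset.sum_congr rfl fun j _ => ?_
    rw [ENNReal.ofReal_mul (hw j).le, ENNReal.ofReal_add (hs j) (hω j).le]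
  have hm : ∀ j, AEMeasurable (fun ω => ENNReal.ofReal ((π.schedule fun i => P i ω).start j) +
      ENNReal.ofReal (P j ω)) μ := fun j =>
    (π.aemeasurable_start hP j).add (hP j).ennreal_ofReal
  rw [h1, lintegral_finsetSum' _ fun j _ => (hm j).const_mul _]
  refine Finset.sum_congr rfl fun j _ => ?_
  rw [lintegral_const_mul'' _ (hm j),
    lintegral_add_right' _ (hP j).ennreal_ofReal]

/-! ### Layer-cake reduction to weights equal to expected processing times. -/

/-- A weighted sum as an integral over the superlevel sets of the weights. -/
theorem sum_ofReal_mul_eq_lintegral {ι : Type*} [Fintype ι] (ρ : ι → ℝ) (a : ι → ℝ≥0∞) :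
    ∑ j, ENNReal.ofReal (ρ j) * a j =
      ∫⁻ c in Set.Ioi (0 : ℝ), ∑ j ∈ Finset.univ.filter (fun j => c ≤ ρ j), a j := by
  have h : ∀ j, ENNReal.ofReal (ρ j) * a j =
      ∫⁻ c in Set.Ioi (0 : ℝ), (Set.Iic (ρ j)).indicator (fun _ => a j) c := by
    intro j
    rw [lintegral_indicator_const measurableSet_Iic, Measure.restrict_apply measurableSet_Iic,
      Set.inter_comm, Set.Ioi_inter_Iic, Real.volume_Ioc, sub_zero, mul_comm]
  simp_rw [h]
  rw [← lintegral_finsetSum _ fun j _ => measurable_const.indicator measurableSet_Iic]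
  refine lintegral_congr fun c => ?_
  rw [Finset.sum_filter]
  rfl

theorem sum_ofReal_mul_le {ι : Type*} [Fintype ι] (ρ : ι → ℝ) (a b : ι → ℝ≥0∞)
    (h : ∀ c, ∑ j ∈ Finset.univ.filter (fun j => c ≤ ρ j), a j ≤
      ∑ j ∈ Finset.univ.filter (fun j => c ≤ ρ j), b j) :
    ∑ j, ENNReal.ofReal (ρ j) * a j ≤ ∑ j, ENNReal.ofReal (ρ j) * b j := by
  rw [sum_ofReal_mul_eq_lintegral, sum_ofReal_mul_eq_lintegral]
  exact lintegral_mono fun c => h c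

/-- A greedy schedule remains greedy when restricted to the jobs of large ratio. -/
theorem Policy.IsGreedyInOrder.exists_busy {π : Policy n m} {ρ : Fin n → ℝ}
    (hπ : π.IsGreedyInOrder ρ) {p : Fin n → ℝ} (hp : ∀ j, 0 < p j) (c : ℝ) :
    ∀ j ∈ Finset.univ.filter (fun j => c ≤ ρ j), ∀ t, 0 ≤ t → t < (π.schedule p).start j → ∀ k,
      ∃ i ∈ Finset.univ.filter (fun j => c ≤ ρ j), (π.schedule p).machine i = k ∧
        (π.schedule p).start i ≤ t ∧ t < (π.schedule p).completion p i := by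
  intro j hj t ht htj k
  obtain ⟨i, hk, h1, h2⟩ := (hπ p hp).2 j t ht htj k
  refine ⟨i, ?_, hk, h1, h2⟩
  simp only [Finset.mem_filter, Finset.mem_univ, true_and] at hj ⊢
  by_contra hi
  -- A job of ratio below `c` cannot start before `j`, whereas `i` has started by time `t`.
  have := (hπ p hp).1 j i (by linarith)
  linarith

/-- The bound for jobs whose weights equal their expected processing times. -/
theorem Policy.IsGreedyInOrder.sum_lintegral_mul_start_le {π π' : Policy n m} {ρ : Fin n → ℝ}
    (hπ : π.IsGreedyInOrder ρ) (hP : ∀ j, AEMeasurable (P j) μ)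
    (hind : iIndepFun P μ) (hpos : ∀ j, ∀ᵐ ω ∂μ, 0 < P j ω) (c : ℝ) :
    ∑ j ∈ Finset.univ.filter (fun j => c ≤ ρ j), (∫⁻ ω, ENNReal.ofReal (P j ω) ∂μ) *
        ∫⁻ ω, ENNReal.ofReal ((π.schedule fun i => P i ω).start j) ∂μ ≤
      ENNReal.ofReal (1 + 1 / 2 * (√2 - 1)) *
        ∑ j ∈ Finset.univ.filter (fun j => c ≤ ρ j), (∫⁻ ω, ENNReal.ofReal (P j ω) ∂μ) *
          ∫⁻ ω, ENNReal.ofReal ((π'.schedule fun i => P i ω).start j) ∂μ +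
      ENNReal.ofReal (1 / 2 * (√2 - 1)) *
        ∑ j ∈ Finset.univ.filter (fun j => c ≤ ρ j), ∫⁻ ω, ENNReal.ofReal (P j ω ^ 2) ∂μ := by
  set J := Finset.univ.filter (fun j => c ≤ ρ j)
  have hb : 0 ≤ 1 / 2 * (√2 - 1) := by
    have : 1 ≤ √2 := by rw [Real.le_sqrt] <;> norm_num
    linarith
  have hm : ∀ (π : Policy n m) (j : Fin n), AEMeasurable (fun ω => ENNReal.ofReal (P j ω) *
      ENNReal.ofReal ((π.schedule fun i => P i ω).start j)) μ := fun π j =>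
    (hP j).ennreal_ofReal.mul (π.aemeasurable_start hP j)
  have hm2 : ∀ j, AEMeasurable (fun ω => ENNReal.ofReal (P j ω ^ 2)) μ := fun j =>
    ((hP j).pow_const 2).ennreal_ofReal
  simp_rw [← Policy.lintegral_mul_start _ hP hind hpos]
  rw [← lintegral_finsetSum' _ fun j _ => hm π j, ← lintegral_finsetSum' _ fun j _ => hm π' j,
    ← lintegral_finsetSum' _ fun j _ => hm2 j,
    ← lintegral_const_mul'' _ (Finset.aemeasurable_fun_sum _ fun j _ => hm π' j),
    ← lintegral_const_mul'' _ (Finset.aemeasurable_fun_sum _ fun j _ => hm2 j),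
    ← lintegral_add_right' _ ((Finset.aemeasurable_fun_sum _ fun j _ => hm2 j).const_mul _)]
  refine lintegral_mono_ae ?_
  filter_upwards [ae_all_iff.2 hpos] with ω hω
  have hsum : ∀ π : Policy n m, ∑ j ∈ J, ENNReal.ofReal (P j ω) *
      ENNReal.ofReal ((π.schedule fun i => P i ω).start j) =
        ENNReal.ofReal (∑ j ∈ J, P j ω * (π.schedule fun i => P i ω).start j) := by
    intro π
    rw [ENNReal.ofReal_sum_of_nonneg fun j _ =>
      mul_nonneg (hω j).le ((π.feasible _ hω).1 j)]
    exact Finset.sum_congr rfl fun j _ => (ENNReal.ofReal_mul (hω j).le).symm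
  have hnn : 0 ≤ ∑ j ∈ J, P j ω * (π'.schedule fun i => P i ω).start j :=
    Finset.sum_nonneg fun j _ => mul_nonneg (hω j).le ((π'.feasible _ hω).1 j)
  rw [hsum, hsum, ← ENNReal.ofReal_sum_of_nonneg fun j _ => sq_nonneg _,
    ← ENNReal.ofReal_mul (by linarith), ← ENNReal.ofReal_mul hb, ← ENNReal.ofReal_add
      (mul_nonneg (by linarith) hnn) (mul_nonneg hb (Finset.sum_nonneg fun j _ => sq_nonneg _))]
  exact ENNReal.ofReal_le_ofReal (sum_mul_start_le hω (π.feasible _ hω) (π'.feasible _ hω) J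
    (hπ.exists_busy hω c))

theorem lintegral_ofReal_sq_le [IsProbabilityMeasure μ] {X : Ω → ℝ} (hX : MemLp X 2 μ)
    (hXpos : ∀ᵐ ω ∂μ, 0 < X ω) (hE : 0 < ∫ ω, X ω ∂μ) {Δ : ℝ}
    (hΔ : variance X μ / (∫ ω, X ω ∂μ) ^ 2 ≤ Δ) :
    ∫⁻ ω, ENNReal.ofReal (X ω ^ 2) ∂μ ≤
      ENNReal.ofReal (1 + Δ) *
        ((∫⁻ ω, ENNReal.ofReal (X ω) ∂μ) * ∫⁻ ω, ENNReal.ofReal (X ω) ∂μ) := by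
  have hΔ0 : 0 ≤ Δ := (div_nonneg (variance_nonneg _ _) (sq_nonneg _)).trans hΔ
  rw [← ofReal_integral_eq_lintegral_ofReal hX.integrable_sq (ae_of_all _ fun _ => sq_nonneg _),
    ← ofReal_integral_eq_lintegral_ofReal (hX.integrable (by norm_num))
      (hXpos.mono fun _ h => h.le), ← ENNReal.ofReal_mul hE.le,
    ← ENNReal.ofReal_mul (by linarith)]
  refine ENNReal.ofReal_le_ofReal ?_
  have h1 := variance_eq_sub hX
  rw [div_le_iff₀ (by positivity)] at hΔ
  simp only [Pi.pow_apply] at h1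
  nlinarith

theorem Policy.IsWSEPT.expectedCost_le [IsProbabilityMeasure μ] {π : Policy n m} {w : Fin n → ℝ}
    (hπ : π.IsWSEPT w P μ) (hw : ∀ j, 0 < w j)
    (hind : iIndepFun P μ) (hpos : ∀ j, ∀ᵐ ω ∂μ, 0 < P j ω)
    (hsq : ∀ j, MemLp (P j) 2 μ)
    {Δ : ℝ} (hΔ : ∀ j, variance (P j) μ / (∫ ω, P j ω ∂μ) ^ 2 ≤ Δ) (π' : Policy n m) :
    π.expectedCost w P μ ≤
      ENNReal.ofReal (1 + 1 / 2 * (√2 - 1) * (1 + Δ)) * π'.expectedCost w P μ := by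
  -- Without jobs nothing forces Δ ≥ 0, but the cost is 0.
  rcases isEmpty_or_nonempty (Fin n) with hn | ⟨⟨j₀⟩⟩
  · simp [Policy.expectedCost]
  have hΔ0 : 0 ≤ Δ := (div_nonneg (variance_nonneg _ _) (sq_nonneg _)).trans (hΔ j₀)
  have hb : 0 ≤ 1 / 2 * (√2 - 1) := by
    have : 1 ≤ √2 := by rw [Real.le_sqrt] <;> norm_num
    linarith
  have hP : ∀ j, AEMeasurable (P j) μ := fun j => (hsq j).aemeasurable
  have hint : ∀ j, Integrable (P j) μ := fun j => (hsq j).integrable (by norm_num)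
  have hnn : ∀ j, 0 ≤ᵐ[μ] P j := fun j => (hpos j).mono fun _ h => h.le
  have hE : ∀ j, 0 < ∫ ω, P j ω ∂μ := by
    intro j
    rw [integral_pos_iff_support_of_nonneg_ae (hnn j) (hint j)]
    have : Function.support (P j) =ᵐ[μ] Set.univ := by
      filter_upwards [hpos j] with ω hω
      exact propext ⟨fun _ => trivial, fun _ => hω.ne'⟩
    rw [measure_congr this, measure_univ]
    exact one_pos
  set A : Fin n → ℝ≥0∞ := fun j => ∫⁻ ω, ENNReal.ofReal (P j ω) ∂μ
  have hAE : ∀ j, ENNReal.ofReal (∫ ω, P j ω ∂μ) = A j := fun j =>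
    ofReal_integral_eq_lintegral_ofReal (hint j) (hnn j)
  set ρ : Fin n → ℝ := fun j => w j / ∫ ω, P j ω ∂μ
  have hwρ : ∀ j, ENNReal.ofReal (w j) = ENNReal.ofReal (ρ j) * A j := by
    intro j
    rw [← hAE, ← ENNReal.ofReal_mul (div_nonneg (hw j).le (hE j).le),
      div_mul_cancel₀ _ (hE j).ne']
  have hcost : ∀ π : Policy n m, π.expectedCost w P μ = ∑ j, ENNReal.ofReal (ρ j) * (A j *
      (∫⁻ ω, ENNReal.ofReal ((π.schedule fun i => P i ω).start j) ∂μ + A j)) := by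
    intro π
    rw [π.expectedCost_eq hw hP hpos]
    exact Finset.sum_congr rfl fun j _ => by rw [hwρ, mul_assoc]
  have hK1 : ENNReal.ofReal (1 + 1 / 2 * (√2 - 1)) ≤
      ENNReal.ofReal (1 + 1 / 2 * (√2 - 1) * (1 + Δ)) :=
    ENNReal.ofReal_le_ofReal (by nlinarith)
  have hK2 : ENNReal.ofReal (1 + 1 / 2 * (√2 - 1) * (1 + Δ)) =
      ENNReal.ofReal (1 / 2 * (√2 - 1)) * ENNReal.ofReal (1 + Δ) + 1 := by
    rw [← ENNReal.ofReal_mul hb, ← ENNReal.ofReal_one,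
      ← ENNReal.ofReal_add (mul_nonneg hb (by linarith)) zero_le_one, add_comm]
  generalize ENNReal.ofReal (1 + 1 / 2 * (√2 - 1) * (1 + Δ)) = K at hK1 hK2 ⊢
  rw [hcost, hcost, Finset.mul_sum]
  refine (sum_ofReal_mul_le ρ _ (fun j => K * (A j *
    (∫⁻ ω, ENNReal.ofReal ((π'.schedule fun i => P i ω).start j) ∂μ + A j))) fun c => ?_).trans_eq
      (Finset.sum_congr rfl fun j _ => mul_left_comm _ _ _)
  have key := Policy.IsGreedyInOrder.sum_lintegral_mul_start_le (π' := π') hπ hP hind hpos c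
  set J := Finset.univ.filter (fun j => c ≤ ρ j)
  have hQ : ∑ j ∈ J, ∫⁻ ω, ENNReal.ofReal (P j ω ^ 2) ∂μ ≤
      ENNReal.ofReal (1 + Δ) * ∑ j ∈ J, A j * A j := by
    rw [Finset.mul_sum]
    exact Finset.sum_le_sum fun j _ => lintegral_ofReal_sq_le (hsq j) (hpos j) (hE j) (hΔ j)
  rw [← Finset.mul_sum]
  simp_rw [mul_add]
  rw [Finset.sum_add_distrib, Finset.sum_add_distrib, mul_add]
  calc _ ≤ ENNReal.ofReal (1 + 1 / 2 * (√2 - 1)) * _ +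
        ENNReal.ofReal (1 / 2 * (√2 - 1)) * (ENNReal.ofReal (1 + Δ) * ∑ j ∈ J, A j * A j) +
          ∑ j ∈ J, A j * A j := by
        refine add_le_add_left (key.trans ?_) _
        gcongr
    _ = ENNReal.ofReal (1 + 1 / 2 * (√2 - 1)) * _ + K * ∑ j ∈ J, A j * A j := by
        rw [hK2, add_mul, one_mul, mul_assoc, add_assoc]
    _ ≤ _ := by gcongr

end Stochastic

/-! ### Existence of a WSEPT policy: list scheduling. -/

section ListScheduling

variable {n m : ℕ} [NeZero m]

theorem exists_minimizer (L : Fin m → ℝ) :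
    (Finset.univ.filter fun k => ∀ l, L k ≤ L l).Nonempty := by
  obtain ⟨k, -, hk⟩ := Finset.univ.exists_min_image L ⟨0, Finset.mem_univ _⟩
  exact ⟨k, by simpa using hk⟩

/-- The first index at which `L` attains its minimum. -/
noncomputable def minIndex (L : Fin m → ℝ) : Fin m :=
  (Finset.univ.filter fun k => ∀ l, L k ≤ L l).min' (exists_minimizer L)

theorem apply_minIndex_le (L : Fin m → ℝ) (l : Fin m) : L (minIndex L) ≤ L l :=
  (Finset.mem_filter.1 (Finset.min'_mem _ (exists_minimizer L))).2 l

/-- The choice depends only on the set of minimizers, which is all that an observer at the time of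
the start knows about the loads. -/
theorem minIndex_congr {L L' : Fin m → ℝ} (h : ∀ k, (∀ l, L k ≤ L l) ↔ ∀ l, L' k ≤ L' l) :
    minIndex L = minIndex L' := by
  simp only [minIndex, h]

theorem measurable_minIndex : Measurable (minIndex (m := m)) := by
  refine measurable_to_countable' fun k => ?_
  have : minIndex (m := m) ⁻¹' {k} =
      {L | (∀ l, L k ≤ L l) ∧ ∀ i, (∀ l, L i ≤ L l) → k ≤ i} := by
    ext L
    simp [minIndex, Finset.min'_eq_iff]
  rw [this]
  measurability

/-- The machine loads after list scheduling the first jobs of a sequence with processing times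
`q`. -/
noncomputable def listLoad (q : ℕ → ℝ) : ℕ → Fin m → ℝ
  | 0 => 0
  | r + 1 => Function.update (listLoad q r) (minIndex (listLoad q r))
      (listLoad q r (minIndex (listLoad q r)) + q r)

/-- The machine on which list scheduling processes a job. -/
noncomputable def listMachine (q : ℕ → ℝ) (r : ℕ) : Fin m := minIndex (listLoad q r)

/-- The time at which list scheduling on `m` machines starts a job. -/
noncomputable def listStart (m : ℕ) [NeZero m] (q : ℕ → ℝ) (r : ℕ) : ℝ :=
  listLoad (m := m) q r (listMachine q r)

theorem listLoad_succ (q : ℕ → ℝ) (r : ℕ) (k : Fin m) :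
    listLoad q (r + 1) k =
      if k = listMachine q r then listStart m q r + q r else listLoad q r k := by
  rw [listLoad, Function.update_apply]
  rfl

theorem listStart_le (q : ℕ → ℝ) (r : ℕ) (k : Fin m) : listStart m q r ≤ listLoad q r k :=
  apply_minIndex_le _ _

theorem monotone_listLoad {q : ℕ → ℝ} (hq : ∀ r, 0 < q r) :
    Monotone (listLoad (m := m) q) := by
  refine monotone_nat_of_le_succ fun r k => ?_
  rw [listLoad_succ]
  split_ifs with h
  · rw [h]
    exact (lt_add_of_pos_right _ (hq r)).le
  · exact le_rfl

theorem monotone_listStart {q : ℕ → ℝ} (hq : ∀ r, 0 < q r) : Monotone (listStart m q) :=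
  fun r _ hrs => (listStart_le q r _).trans (monotone_listLoad hq hrs _)

theorem listStart_nonneg {q : ℕ → ℝ} (hq : ∀ r, 0 < q r) (r : ℕ) : 0 ≤ listStart m q r :=
  monotone_listLoad hq (Nat.zero_le r) _

theorem listCompletion_le {q : ℕ → ℝ} (hq : ∀ r, 0 < q r) {i r : ℕ} (hir : i < r) :
    listStart m q i + q i ≤ listLoad q r (listMachine (m := m) q i) := by
  have h := monotone_listLoad (m := m) hq (Nat.succ_le_of_lt hir) (listMachine q i)
  rwa [Nat.succ_eq_add_one, listLoad_succ, if_pos rfl] at h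

theorem exists_busy_of_lt_listLoad (q : ℕ → ℝ) (r : ℕ) (k : Fin m) (t : ℝ) (ht : 0 ≤ t)
    (htr : t < listLoad q r k) :
    ∃ i < r, listMachine q i = k ∧ listStart m q i ≤ t ∧ t < listStart m q i + q i := by
  induction r with
  | zero => exact absurd htr ht.not_gt
  | succ r ih =>
    by_cases h : t < listLoad q r k
    · obtain ⟨i, hi, h'⟩ := ih h
      exact ⟨i, hi.trans r.lt_succ_self, h'⟩
    · rw [listLoad_succ] at htr
      split_ifs at htr with hk
      · exact ⟨r, r.lt_succ_self, hk.symm, (listStart_le q r k).trans (not_lt.1 h), htr⟩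
      · exact absurd htr h

/-- A nonempty machine's load is the completion time of its last job, which the realizations either
share or both place after `t`. -/
theorem listLoad_eq_or_lt {q q' : ℕ → ℝ} {t : ℝ} (r : ℕ)
    (h : ∀ i < r, listStart m q i = listStart m q' i ∧
      listMachine (m := m) q i = listMachine q' i ∧
      (q i = q' i ∨ (t < listStart m q i + q i ∧ t < listStart m q' i + q' i))) (k : Fin m) :
    listLoad q r k = listLoad q' r k ∨ (t < listLoad q r k ∧ t < listLoad q' r k) := by
  induction r with
  | zero => exact Or.inl rfl
  | succ r ih =>
    obtain ⟨h1, h2, h3⟩ := h r r.lt_succ_self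
    rw [listLoad_succ, listLoad_succ, ← h2]
    split_ifs with hk
    · rcases h3 with h3 | h3
      · exact Or.inl (by rw [h1, h3])
      · exact Or.inr h3
    · exact ih fun i hi => h i (hi.trans r.lt_succ_self)

theorem listStart_nonanticipative {q q' : ℕ → ℝ} (hq : ∀ r, 0 < q r) (hq' : ∀ r, 0 < q' r)
    (t : ℝ) (r : ℕ)
    (h : ∀ i < r, listStart m q i < t → listStart m q i = listStart m q' i ∧
      listMachine (m := m) q i = listMachine q' i ∧
      (q i = q' i ∨ (t < listStart m q i + q i ∧ t < listStart m q' i + q' i)))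
    (hr : listStart m q r = t) :
    listStart m q' r = t ∧ listMachine (m := m) q' r = listMachine q r := by
  induction r using Nat.strong_induction_on with
  | _ r ih =>
    have hall : ∀ i < r, listStart m q i = listStart m q' i ∧
        listMachine (m := m) q i = listMachine q' i ∧
        (q i = q' i ∨ (t < listStart m q i + q i ∧ t < listStart m q' i + q' i)) := by
      intro i hi
      have hit : listStart m q i ≤ t := hr ▸ monotone_listStart hq hi.le
      rcases hit.lt_or_eq with hit | hit
      · exact h i hi hit
      -- Earlier jobs of the list may start exactly at `t`; induction settles them, and positivity
      -- makes them unfinished at `t`.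
      · obtain ⟨h1, h2⟩ := ih i hi (fun l hl => h l (hl.trans hi)) hit
        have := hq i
        have := hq' i
        exact ⟨hit.trans h1.symm, h2.symm, Or.inr ⟨by linarith, by linarith⟩⟩
    have hload := listLoad_eq_or_lt r hall
    have hmin : ∀ k, t ≤ listLoad (m := m) q r k := fun k => hr ▸ listStart_le q r k
    have hmin' : ∀ k, t ≤ listLoad (m := m) q' r k := by
      intro k
      rcases hload k with h | h
      · exact h ▸ hmin k
      · exact h.2.le
    have hat : listLoad q r (listMachine (m := m) q r) = t := hr
    have hat' : listLoad q' r (listMachine (m := m) q r) = t := by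
      rcases hload (listMachine q r) with h | h
      · exact h ▸ hat
      · exact absurd hat h.1.ne'
    have hM : listMachine (m := m) q' r = listMachine q r := by
      -- The minimum load is `t` in both realizations; a machine whose loads differ exceeds `t` in
      -- both and so is never a minimizer.
      refine minIndex_congr fun k => ⟨fun hk l => ?_, fun hk l => ?_⟩
      · have h1 : listLoad q' r k = t := le_antisymm ((hk _).trans hat'.le) (hmin' k)
        rcases hload k with h | h
        · rw [h, h1]; exact hmin l
        · exact absurd h1 h.2.ne'
      · have h1 : listLoad q r k = t := le_antisymm ((hk _).trans hat.le) (hmin k)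
        rcases hload k with h | h
        · rw [← h, h1]; exact hmin' l
        · exact absurd h1 h.1.ne'
    exact ⟨by rw [listStart, hM, hat'], hM⟩

theorem measurable_listLoad {Ω : Type*} [MeasurableSpace Ω] {q : Ω → ℕ → ℝ}
    (hq : ∀ r, Measurable fun ω => q ω r) (r : ℕ) :
    Measurable fun ω => listLoad (m := m) (q ω) r := by
  induction r with
  | zero => exact measurable_const
  | succ r ih =>
    have hM : Measurable fun ω => listMachine (m := m) (q ω) r := measurable_minIndex.comp ih
    refine measurable_pi_lambda _ fun k => ?_
    have h : (fun ω => listLoad (q ω) (r + 1) k) = fun ω =>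
        if listMachine (q ω) r = k then listLoad (q ω) r k + q ω r else listLoad (q ω) r k := by
      funext ω
      rw [listLoad_succ]
      by_cases hk : k = listMachine (q ω) r
      · subst hk; simp [listStart]
      · rw [if_neg hk, if_neg (Ne.symm hk)]
    rw [h]
    have hk := (measurable_pi_apply k).comp ih
    exact Measurable.ite (hM (measurableSet_singleton k)) (hk.add (hq r)) hk

theorem measurable_listStart {Ω : Type*} [MeasurableSpace Ω] {q : Ω → ℕ → ℝ}
    (hq : ∀ r, Measurable fun ω => q ω r) (r : ℕ) :
    Measurable fun ω => listStart m (q ω) r := by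
  have h : (fun ω => listStart m (q ω) r) = fun ω =>
      ∑ k, if listMachine (q ω) r = k then listLoad (m := m) (q ω) r k else 0 := by
    funext ω
    rw [Finset.sum_ite_eq, if_pos (Finset.mem_univ _), listStart]
  rw [h]
  have hl := measurable_listLoad (m := m) hq r
  exact Finset.measurable_fun_sum _ fun k _ => Measurable.ite
    ((measurable_minIndex.comp hl) (measurableSet_singleton k))
    ((measurable_pi_apply k).comp hl) measurable_const

/-- The processing times in the order given by `σ`, continued by ones. -/
def listTimes (σ : Equiv.Perm (Fin n)) (p : Fin n → ℝ) (r : ℕ) : ℝ :=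
  if h : r < n then p (σ ⟨r, h⟩) else 1

theorem listTimes_pos (σ : Equiv.Perm (Fin n)) {p : Fin n → ℝ} (hp : ∀ j, 0 < p j) (r : ℕ) :
    0 < listTimes σ p r := by
  unfold listTimes
  split_ifs
  · exact hp _
  · exact one_pos

theorem listTimes_symm (σ : Equiv.Perm (Fin n)) (p : Fin n → ℝ) (j : Fin n) :
    listTimes σ p (σ.symm j) = p j := by
  simp [listTimes]

theorem measurable_listTimes (σ : Equiv.Perm (Fin n)) (r : ℕ) :
    Measurable fun p : Fin n → ℝ => listTimes σ p r := by
  unfold listTimes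
  split_ifs
  · exact measurable_pi_apply _
  · exact measurable_const

/-- List scheduling in the order given by `σ`: each job goes to a machine of least load. -/
noncomputable def listPolicy (m : ℕ) [NeZero m] (σ : Equiv.Perm (Fin n)) : Policy n m where
  schedule p :=
    { machine := fun j => listMachine (listTimes σ p) (σ.symm j)
      start := fun j => listStart m (listTimes σ p) (σ.symm j) }
  measurable_start j := measurable_listStart (measurable_listTimes σ) _
  feasible p hp := by
    have hq := listTimes_pos σ hp
    refine ⟨fun j => listStart_nonneg hq _, fun i j hij hM => ?_⟩
    simp only [Schedule.completion] at hM ⊢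
    rw [← listTimes_symm σ p i, ← listTimes_symm σ p j]
    rcases lt_or_gt_of_ne (Fin.val_ne_of_ne (σ.symm.injective.ne hij)) with h | h
    · left
      refine (listCompletion_le hq h).trans ?_
      rw [hM, listStart]
    · right
      refine (listCompletion_le hq h).trans ?_
      rw [← hM, listStart]
  nonanticipative p p' hp hp' t hpast j hj := by
    refine listStart_nonanticipative (listTimes_pos σ hp) (listTimes_pos σ hp') t _
      (fun i hi hit => ?_) hj
    have hin : i < n := hi.trans (Fin.is_lt _)
    have h := hpast (σ ⟨i, hin⟩)
    simp only [Schedule.completion, Equiv.symm_apply_apply] at h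
    simpa [listTimes, hin] using h (Or.inl hit)

theorem isGreedyInOrder_listPolicy (σ : Equiv.Perm (Fin n)) {ρ : Fin n → ℝ}
    (hσ : Antitone (ρ ∘ σ)) : (listPolicy m σ).IsGreedyInOrder ρ := by
  intro p hp
  refine ⟨fun i j hij => monotone_listStart (listTimes_pos σ hp) ?_, fun j t ht htj k => ?_⟩
  · by_contra h
    have := hσ (Fin.le_def.2 (not_le.1 h).le)
    simp only [Function.comp_apply, Equiv.apply_symm_apply] at this
    linarith
  · obtain ⟨i, hi, hk, h1, h2⟩ := exists_busy_of_lt_listLoad (listTimes σ p) (σ.symm j) k t ht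
      (lt_of_lt_of_le htj (listStart_le _ _ k))
    have hin : i < n := hi.trans (Fin.is_lt _)
    have hp : listTimes σ p i = p (σ ⟨i, hin⟩) := by simp [listTimes, hin]
    refine ⟨σ ⟨i, hin⟩, ?_, ?_, ?_⟩
    · simpa [listPolicy] using hk
    · simpa [listPolicy] using h1
    · simpa [listPolicy, Schedule.completion, hp] using h2

theorem exists_isGreedyInOrder (m : ℕ) [NeZero m] (ρ : Fin n → ℝ) :
    ∃ π : Policy n m, π.IsGreedyInOrder ρ := by
  -- `Tuple.sort` sorts increasingly, hence the sign.
  refine ⟨listPolicy m (Tuple.sort fun j => -ρ j), isGreedyInOrder_listPolicy _ fun i j hij => ?_⟩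
  exact neg_le_neg_iff.1 (Tuple.monotone_sort (fun j => -ρ j) hij)

end ListScheduling

theorem mainTheorem2 {n m : ℕ} (hm : 0 < m)
    {Ω : Type*} [MeasurableSpace Ω] (μ : Measure Ω) [IsProbabilityMeasure μ]
    (w : Fin n → ℝ) (hw : ∀ j, 0 < w j)
    (P : Fin n → Ω → ℝ) (hP_indep : iIndepFun P μ) (hP_pos : ∀ j, ∀ᵐ ω ∂μ, 0 < P j ω)
    (hP_sq : ∀ j, MemLp (P j) 2 μ)
    (Δ : ℝ) (hΔ : ∀ j, variance (P j) μ / (∫ ω, P j ω ∂μ) ^ 2 ≤ Δ) :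
    (∃ π : Policy n m, π.IsWSEPT w P μ) ∧
      ∀ π : Policy n m, π.IsWSEPT w P μ →
        π.expectedCost w P μ ≤
          ENNReal.ofReal (1 + 1 / 2 * (√2 - 1) * (1 + Δ)) * optimalExpectedCost m w P μ := by
  have : NeZero m := ⟨hm.ne'⟩
  refine ⟨exists_isGreedyInOrder m _, fun π hπ => ?_⟩
  unfold optimalExpectedCost
  have : Nonempty (Policy n m) := ⟨π⟩
  rw [ENNReal.mul_iInf fun h => absurd h ENNReal.ofReal_ne_top]
  exact le_iInf fun π' => hπ.expectedCost_le hw hP_indep hP_pos hP_sq hΔ π'
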